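/- Let $\Omega\subset\mathbb{R}^n$ be nonempty, closed and convex, and let $F:\Omega\to\mathbb{R}^n$ be continuous and monotone, i.e. $\langle F(x)-F(y),x-y\rangle\ge 0$ for all $x,y\in\Omega$. Assume that $F$ is coercive with respect to $\Omega$: for every $x_0\in\Omega$ there is $\gamma>0$ with $$\liminf_{\|x\|\to\infty,\ x\in\Omega}\frac{\langle F(x),x-x_0\rangle}{\|x\|^{\gamma}}>0$$ (the lower limit being $+\infty$ if $\Omega$ is bounded). Let $\varphi:\Omega\to\mathbb{R}$ be strongly convex, i.e. for some $\rho>0$, $\varphi(tx+(1-t)y)\le t\varphi(x)+(1-t)\varphi(y)-\tfrac{\rho}{2}t(1-t)\|x-y\|^2$ for all $x,y\in\Omega$, $t\in[0,1]$, and Fréchet differentiable on $\Omega$ with gradient $\nabla\varphi:\Omega\to\mathbb{R}^n$, i.e. $\varphi(y)=\varphi(x)+\langle\nabla\varphi(x),y-x\rangle+o(\|y-x\|)$ as $y\to x$ in $\Omega$, for every $x\in\Omega$ (for instance, the restriction to $\Omega$ of the usual gradient of a function differentiable on $\mathbb{R}^n$). Then for every $\varepsilon>0$ the variational inequality $\mathrm{VI}(F+\varepsilon\nabla\varphi,\Omega)$,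 that is, to find $x\in\Omega$ with $$\langle F(x)+\varepsilon\nabla\varphi(x),\,y-x\rangle\ge 0\qquad\text{for all } y\in\Omega,$$ has exactly one solution $x_\varepsilon$, and the map $(0,\infty)\to\mathbb{R}^n$, $\varepsilon\mapsto x_\varepsilon$, is continuous. -/

import Mathlib

/-- The solution set of the variational inequality `VI(T, Ω)`: the points `x ∈ Ω` with
`⟨T x, y - x⟩ ≥ 0` for all `y ∈ Ω`. Only the values of `T` on `Ω` matter. -/
def viSol {n : ℕ} (T : EuclideanSpace ℝ (Fin n) → EuclideanSpace ℝ (Fin n))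
    (Ω : Set (EuclideanSpace ℝ (Fin n))) : Set (EuclideanSpace ℝ (Fin n)) :=
  {x | x ∈ Ω ∧ ∀ y ∈ Ω, 0 ≤ inner ℝ (T x) (y - x)}

/-- `F` is monotone on `Ω` in the sense of operators: `⟨F x - F y, x - y⟩ ≥ 0` on `Ω`. -/
def IsMonotoneMapOn {n : ℕ} (F : EuclideanSpace ℝ (Fin n) → EuclideanSpace ℝ (Fin n))
    (Ω : Set (EuclideanSpace ℝ (Fin n))) : Prop :=
  ∀ x ∈ Ω, ∀ y ∈ Ω, 0 ≤ inner ℝ (F x - F y) (x - y)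

/-- `F` is coercive with respect to `Ω`: for every `x₀ ∈ Ω` there is `γ > 0` such that
`liminf ⟨F x, x - x₀⟩ / ‖x‖ ^ γ > 0` as `‖x‖ → ∞` with `x ∈ Ω`. The lower limit is taken in the
extended reals, so it is `+∞` (and the condition holds) when `Ω` is bounded. -/
def IsCoerciveMapOn {n : ℕ} (F : EuclideanSpace ℝ (Fin n) → EuclideanSpace ℝ (Fin n))
    (Ω : Set (EuclideanSpace ℝ (Fin n))) : Prop :=
  ∀ x₀ ∈ Ω, ∃ γ : ℝ, 0 < γ ∧
    (0 : EReal) < Filter.liminf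
      (fun x => ((inner ℝ (F x) (x - x₀) / ‖x‖ ^ γ : ℝ) : EReal))
      (Bornology.cobounded (EuclideanSpace ℝ (Fin n)) ⊓ Filter.principal Ω)

/-! Since `∇φ` need not be continuous, existence is obtained from the Minty form of the variational
inequality in which `∇φ` is integrated back to `φ`: find `x ∈ Ω` with
`⟨F y, x - y⟩ + φ x - φ y ≤ 0` for all `y ∈ Ω`. The left-hand side is convex in `x`, and exchanging
`x` and `y` makes two such expressions add up to at most `0`; by the minimax theorem, finitely many
of these inequalities have a common solution. Their solution sets are closed and convex, and bounded
by strong convexity, so weak compactness gives a common solution of all of them; letting `y` tend to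
`x` along segments shows that it solves `VI(F + ∇φ, Ω)`. Replace `φ` by `ε φ` for `ε > 0`.

For uniqueness and continuity, add the inequalities for `x_ε` and `x_δ`. Monotonicity of `F` and
strong monotonicity of `∇φ` give `ε ρ ‖x_ε - x_δ‖ ≤ |ε - δ| ‖∇φ(x_δ)‖`. -/

open Filter Topology Bornology
open scoped InnerProductSpace Matrix

section Minimax

theorem dotProduct_mulVec_self_nonpos {ι R : Type*} [Fintype ι] [CommRing R] [LinearOrder R]
    [IsStrictOrderedRing R] {A : Matrix ι ι R} (hA : ∀ i j, A i j + A j i ≤ 0)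
    {p : ι → R} (hp : 0 ≤ p) : p ⬝ᵥ A *ᵥ p ≤ 0 := by
  have hsymm : p ⬝ᵥ (A + Aᵀ) *ᵥ p = 2 * (p ⬝ᵥ A *ᵥ p) := by
    rw [Matrix.add_mulVec, dotProduct_add, Matrix.mulVec_transpose, dotProduct_comm p (p ᵥ* A),
      ← Matrix.dotProduct_mulVec, two_mul]
  have hnonpos : p ⬝ᵥ (A + Aᵀ) *ᵥ p ≤ 0 :=
    Finset.sum_nonpos fun i _ ↦ mul_nonpos_of_nonneg_of_nonpos (hp i) <|
      Finset.sum_nonpos fun j _ ↦ mul_nonpos_of_nonpos_of_nonneg (hA i j) (hp j)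
  linarith

theorem exists_stdSimplex_mulVec_nonpos {ι : Type*} [Fintype ι] [Nonempty ι] {A : Matrix ι ι ℝ}
    (hA : ∀ i j, A i j + A j i ≤ 0) : ∃ p ∈ stdSimplex ℝ ι, A *ᵥ p ≤ 0 := by
  classical
  have hne : (stdSimplex ℝ ι).Nonempty := ⟨_, single_mem_stdSimplex ℝ (Classical.arbitrary ι)⟩
  have hcompact : IsCompact (stdSimplex ℝ ι) := isCompact_stdSimplex ℝ ι
  have hconv : Convex ℝ (stdSimplex ℝ ι) := convex_stdSimplex ℝ ι
  let B : (ι → ℝ) →ₗ[ℝ] (ι → ℝ) →ₗ[ℝ] ℝ := Matrix.toLinearMap₂' ℝ A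
  have hB (q p : ι → ℝ) : B q p = q ⬝ᵥ A *ᵥ p := Matrix.toLinearMap₂'_apply' A q p
  obtain ⟨p, hp, q, hq, hsaddle⟩ := Sion.exists_isSaddlePointOn (f := fun p q ↦ B q p)
    hne hconv hcompact
    (fun q _ ↦ (B q).continuous_of_finiteDimensional.lowerSemicontinuous.lowerSemicontinuousOn _)
    (fun q _ ↦ ((B q).convexOn hconv).quasiconvexOn)
    hconv hne hcompact
    (fun p _ ↦
      (B.flip p).continuous_of_finiteDimensional.upperSemicontinuous.upperSemicontinuousOn _)
    (fun p _ ↦ ((B.flip p).concaveOn hconv).quasiconcaveOn)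
  refine ⟨p, hp, fun i ↦ ?_⟩
  calc (A *ᵥ p) i = B (Pi.single i 1) p := by rw [hB, single_one_dotProduct]
    _ ≤ B q q := hsaddle q hq _ (single_mem_stdSimplex ℝ i)
    _ ≤ 0 := hB q q ▸ dotProduct_mulVec_self_nonpos hA hq.1

theorem exists_forall_mem_finset_bifunction_nonpos {V : Type*} [AddCommGroup V] [Module ℝ V]
    {s : Set V} {f : V → V → ℝ} (hconv : ∀ y ∈ s, ConvexOn ℝ s (f y))
    (hmono : ∀ x ∈ s, ∀ y ∈ s, f x y + f y x ≤ 0)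
    {u : Finset V} (hu : u.Nonempty) (hus : ↑u ⊆ s) : ∃ x ∈ s, ∀ y ∈ u, f y x ≤ 0 := by
  have : Nonempty u := hu.to_subtype
  have hmem (i : u) : (i : V) ∈ s := hus i.2
  obtain ⟨p, hp, hle⟩ := exists_stdSimplex_mulVec_nonpos (A := .of fun i j : u ↦ f i j)
    fun i j ↦ hmono i (hmem i) j (hmem j)
  refine ⟨∑ j, p j • (j : V), ?_, fun y hy ↦ ?_⟩
  · obtain ⟨i⟩ := this
    exact (hconv i (hmem i)).1.sum_mem (fun j _ ↦ hp.1 j) hp.2 fun j _ ↦ hmem j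
  · calc f y (∑ j, p j • (j : V)) ≤ ∑ j, p j • f y j :=
          (hconv y (hus hy)).map_sum_le (fun j _ ↦ hp.1 j) hp.2 fun j _ ↦ hmem j
      _ = (Matrix.of (fun i j : u ↦ f i j) *ᵥ p) ⟨y, hy⟩ :=
          Finset.sum_congr rfl fun j _ ↦ mul_comm _ _
      _ ≤ 0 := hle ⟨y, hy⟩

end Minimax

section WeakCompactness

theorem isClosed_toWeakSpace_image {V : Type*} [AddCommGroup V] [Module ℝ V]
    [TopologicalSpace V] [IsTopologicalAddGroup V] [ContinuousSMul ℝ V] [LocallyConvexSpace ℝ V]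
    {K : Set V} (hconv : Convex ℝ K) (hcl : IsClosed K) : IsClosed (toWeakSpace ℝ V '' K) := by
  rw [← closure_eq_iff_isClosed, ← hconv.toWeakSpace_closure ℝ, hcl.closure_eq]

variable {E : Type*} [NormedAddCommGroup E] [InnerProductSpace ℝ E] [CompleteSpace E]

theorem inclusionInDoubleDual_surjective :
    Function.Surjective (NormedSpace.inclusionInDoubleDual ℝ E) := by
  intro Φ
  let toDual : E ≃ₗᵢ[ℝ] StrongDual ℝ E := InnerProductSpace.toDual ℝ E
  refine ⟨toDual.symm (Φ.comp (toDual : E →L[ℝ] StrongDual ℝ E)), ?_⟩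
  ext ℓ
  obtain ⟨x, rfl⟩ := toDual.surjective ℓ
  calc toDual x (toDual.symm (Φ.comp (toDual : E →L[ℝ] StrongDual ℝ E)))
      = toDual (toDual.symm (Φ.comp (toDual : E →L[ℝ] StrongDual ℝ E))) x :=
        real_inner_comm _ _
    _ = Φ (toDual x) := by rw [toDual.apply_symm_apply]; rfl

theorem isCompact_toWeakSpace_image {K : Set E} (hconv : Convex ℝ K) (hcl : IsClosed K)
    (hbdd : IsBounded K) : IsCompact (toWeakSpace ℝ E '' K) := by
  rw [← (isClosed_toWeakSpace_image hconv hcl).closure_eq]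
  refine NormedSpace.isCompact_closure_of_isBounded ℝ E _ ?_ fun Φ _ ↦ ?_
  · rwa [Set.preimage_image_eq _ (toWeakSpace ℝ E).injective]
  · obtain ⟨x, hx⟩ := inclusionInDoubleDual_surjective (E := E) Φ
    exact ⟨toWeakSpace ℝ E x, hx⟩

theorem nonempty_iInter_of_convex_of_isClosed_of_isBounded {ι : Type*} {K : ι → Set E}
    (hconv : ∀ i, Convex ℝ (K i)) (hcl : ∀ i, IsClosed (K i)) {i₀ : ι} (hbdd : IsBounded (K i₀))
    (hfin : ∀ u : Finset ι, u.Nonempty → (⋂ i ∈ u, K i).Nonempty) : (⋂ i, K i).Nonempty := by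
  classical
  obtain ⟨z, -, hz⟩ :=
    (isCompact_toWeakSpace_image (hconv i₀) (hcl i₀) hbdd).inter_iInter_nonempty
      (fun i ↦ toWeakSpace ℝ E '' K i) (fun i ↦ isClosed_toWeakSpace_image (hconv i) (hcl i))
      fun u ↦ by
        obtain ⟨x, hx⟩ := hfin (insert i₀ u) (Finset.insert_nonempty _ _)
        rw [Set.mem_iInter₂] at hx
        exact ⟨toWeakSpace ℝ E x, Set.mem_image_of_mem _ (hx _ (Finset.mem_insert_self _ _)),
          Set.mem_iInter₂.2 fun i hi ↦
            Set.mem_image_of_mem _ (hx i (Finset.mem_insert_of_mem hi))⟩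
  refine ⟨(toWeakSpace ℝ E).symm z, Set.mem_iInter.2 fun i ↦ ?_⟩
  obtain ⟨x, hxK, rfl⟩ := Set.mem_iInter.1 hz i
  simpa only [LinearEquiv.symm_apply_apply] using hxK

theorem exists_forall_bifunction_nonpos {s : Set E} {f : E → E → ℝ}
    (hconv : ∀ y ∈ s, ConvexOn ℝ s (f y)) (hmono : ∀ x ∈ s, ∀ y ∈ s, f x y + f y x ≤ 0)
    (hcl : ∀ y ∈ s, IsClosed {x ∈ s | f y x ≤ 0})
    {y₀ : E} (hy₀ : y₀ ∈ s) (hbdd : IsBounded {x ∈ s | f y₀ x ≤ 0}) :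
    ∃ x ∈ s, ∀ y ∈ s, f y x ≤ 0 := by
  classical
  obtain ⟨x, hx⟩ := nonempty_iInter_of_convex_of_isClosed_of_isBounded
    (K := fun y : s ↦ {x ∈ s | f y x ≤ 0}) (fun y ↦ (hconv y y.2).convex_le 0)
    (fun y ↦ hcl y y.2) (i₀ := ⟨y₀, hy₀⟩) hbdd fun u hu ↦ by
      obtain ⟨x, hxs, hx⟩ := exists_forall_mem_finset_bifunction_nonpos hconv hmono
        (hu.image Subtype.val) (by simp)
      exact ⟨x, Set.mem_iInter₂.2 fun y hy ↦ ⟨hxs, hx y (Finset.mem_image_of_mem _ hy)⟩⟩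
  rw [Set.mem_iInter] at hx
  exact ⟨x, (hx ⟨y₀, hy₀⟩).1, fun y hy ↦ (hx ⟨y, hy⟩).2⟩

end WeakCompactness

theorem le_div_of_mul_sq_le_mul {k : Type*} [Field k] [LinearOrder k] [IsStrictOrderedRing k]
    {a b r : k} (ha : 0 < a) (hb : 0 ≤ b) (h : a * r ^ 2 ≤ b * r) : r ≤ b / a := by
  rcases le_or_gt r 0 with hr | hr
  · exact hr.trans (div_nonneg hb ha.le)
  · rw [le_div_iff₀' ha]
    exact le_of_mul_le_mul_right (by rwa [mul_assoc, ← sq]) hr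

section Gradient

theorem tendsto_add_smul_sub_nhdsWithin {V : Type*} [AddCommGroup V] [Module ℝ V]
    [TopologicalSpace V] [ContinuousAdd V] [ContinuousSMul ℝ V] {s : Set V} (hs : Convex ℝ s)
    {x y : V} (hx : x ∈ s) (hy : y ∈ s) :
    Tendsto (fun t : ℝ ↦ x + t • (y - x)) (𝓝[>] 0) (𝓝[s] x) := by
  refine tendsto_nhdsWithin_iff.2 ⟨?_, ?_⟩
  · have hcont : Continuous fun t : ℝ ↦ x + t • (y - x) := by fun_prop
    simpa using (hcont.tendsto 0).mono_left nhdsWithin_le_nhds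
  · filter_upwards [Ioc_mem_nhdsGT (zero_lt_one' ℝ)] with t ht
    exact hs.add_smul_sub_mem hx hy ⟨ht.1.le, ht.2⟩

theorem strongConvexOn_const_mul {V : Type*} [NormedAddCommGroup V] [NormedSpace ℝ V]
    {s : Set V} {φ : V → ℝ} {m c : ℝ} (hφ : StrongConvexOn s m φ) (hc : 0 ≤ c) :
    StrongConvexOn s (c * m) fun x ↦ c * φ x := by
  refine ⟨hφ.1, fun x hx y hy a b ha hb hab ↦ ?_⟩
  have hscaled := mul_le_mul_of_nonneg_left (hφ.2 hx hy ha hb hab) hc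
  simp only [smul_eq_mul] at hscaled ⊢
  linarith

variable {E : Type*} [NormedAddCommGroup E] [InnerProductSpace ℝ E] [CompleteSpace E]
  {s : Set E} {φ : E → ℝ} {m : ℝ} {g : E → E} {x y v : E}

theorem hasGradientWithinAt_const_mul (hφ : HasGradientWithinAt φ v s x) (c : ℝ) :
    HasGradientWithinAt (fun x ↦ c * φ x) (c • v) s x := by
  rw [hasGradientWithinAt_iff_hasFDerivWithinAt, map_smulₛₗ]
  exact hφ.hasFDerivWithinAt.const_mul c

theorem tendsto_slope_segment_of_hasGradientWithinAt (hs : Convex ℝ s)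
    (hφ : HasGradientWithinAt φ v s x) (hx : x ∈ s) (hy : y ∈ s) :
    Tendsto (fun t : ℝ ↦ t⁻¹ * (φ (x + t • (y - x)) - φ x)) (𝓝[>] 0) (𝓝 ⟪v, y - x⟫_ℝ) := by
  have hseg := tendsto_nhdsWithin_iff.1 (tendsto_add_smul_sub_nhdsWithin hs hx hy)
  have hscaled : Tendsto (fun t : ℝ ↦ t⁻¹ • t • (y - x)) (𝓝[>] 0) (𝓝 (y - x)) := by
    refine tendsto_const_nhds.congr' ?_
    filter_upwards [self_mem_nhdsWithin] with t ht
    rw [inv_smul_smul₀ (ne_of_gt ht)]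
  have hlim := hφ.hasFDerivWithinAt.lim (c := fun t : ℝ ↦ t⁻¹) (d := fun t ↦ t • (y - x))
    (by simpa using hseg.1.sub_const x) hseg.2 hscaled
  simpa using hlim

theorem add_inner_add_sq_le_of_strongConvexOn (hφ : StrongConvexOn s m φ)
    (hv : HasGradientWithinAt φ v s x) (hx : x ∈ s) (hy : y ∈ s) :
    φ x + ⟪v, y - x⟫_ℝ + m / 2 * ‖y - x‖ ^ 2 ≤ φ y := by
  have hslope : ∀ᶠ t : ℝ in 𝓝[>] 0, t⁻¹ * (φ (x + t • (y - x)) - φ x) ≤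
      φ y - φ x - (1 - t) * (m / 2 * ‖y - x‖ ^ 2) := by
    filter_upwards [Ioc_mem_nhdsGT (zero_lt_one' ℝ)] with t ht
    have hconv := hφ.2 hy hx ht.1.le (sub_nonneg.2 ht.2) (by ring)
    rw [show t • y + (1 - t) • x = x + t • (y - x) by module] at hconv
    simp only [smul_eq_mul] at hconv
    rw [inv_mul_le_iff₀ ht.1]
    linarith
  have hlim : Tendsto (fun t : ℝ ↦ φ y - φ x - (1 - t) * (m / 2 * ‖y - x‖ ^ 2)) (𝓝[>] 0)
      (𝓝 (φ y - φ x - m / 2 * ‖y - x‖ ^ 2)) := by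
    have hcont : Continuous fun t : ℝ ↦ φ y - φ x - (1 - t) * (m / 2 * ‖y - x‖ ^ 2) := by
      fun_prop
    simpa using (hcont.tendsto 0).mono_left nhdsWithin_le_nhds
  have hinner := le_of_tendsto_of_tendsto
    (tendsto_slope_segment_of_hasGradientWithinAt hφ.1 hv hx hy) hlim hslope
  linarith

theorem mul_norm_sub_sq_le_inner_gradient_sub (hφ : StrongConvexOn s m φ)
    (hg : ∀ x ∈ s, HasGradientWithinAt φ (g x) s x) (hx : x ∈ s) (hy : y ∈ s) :
    m * ‖x - y‖ ^ 2 ≤ ⟪g x - g y, x - y⟫_ℝ := by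
  have hxy := add_inner_add_sq_le_of_strongConvexOn hφ (hg x hx) hx hy
  have hyx := add_inner_add_sq_le_of_strongConvexOn hφ (hg y hy) hy hx
  rw [← neg_sub x y, inner_neg_right, norm_neg] at hxy
  rw [inner_sub_left]
  linarith

theorem isBounded_setOf_inner_add_sub_nonpos (hm : 0 < m) (hφ : StrongConvexOn s m φ)
    (hv : HasGradientWithinAt φ v s y) (hy : y ∈ s) (w : E) :
    IsBounded {x ∈ s | ⟪w, x - y⟫_ℝ + (φ x - φ y) ≤ 0} := by
  refine (Metric.isBounded_closedBall (x := y) (r := ‖w + v‖ / (m / 2))).subset ?_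
  rintro x ⟨hx, hle⟩
  rw [Metric.mem_closedBall, dist_eq_norm]
  refine le_div_of_mul_sq_le_mul (half_pos hm) (norm_nonneg _) ?_
  have hlower := add_inner_add_sq_le_of_strongConvexOn hφ hv hy hx
  have hcauchy := neg_le_of_abs_le (abs_real_inner_le_norm (w + v) (x - y))
  rw [inner_add_left] at hcauchy
  linarith

end Gradient

section VariationalInequality

variable {E : Type*} [NormedAddCommGroup E] [InnerProductSpace ℝ E]
  {s : Set E} {F g : E → E} {φ : E → ℝ} {m ε δ : ℝ} {x y : E}

/-- `x` solves the variational inequality `VI(T, s)` in a real inner product space; in Euclidean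
space this is membership in `viSol T s`. -/
def IsVISolution (T : E → E) (s : Set E) (x : E) : Prop :=
  x ∈ s ∧ ∀ y ∈ s, 0 ≤ ⟪T x, y - x⟫_ℝ

namespace IsVISolution

theorem norm_sub_le (hF : ∀ x ∈ s, ∀ y ∈ s, 0 ≤ ⟪F x - F y, x - y⟫_ℝ) (hm : 0 < m)
    (hg : ∀ x ∈ s, ∀ y ∈ s, m * ‖x - y‖ ^ 2 ≤ ⟪g x - g y, x - y⟫_ℝ) (hε : 0 < ε)
    (hx : IsVISolution (fun x ↦ F x + ε • g x) s x)
    (hy : IsVISolution (fun x ↦ F x + δ • g x) s y) :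
    ‖x - y‖ ≤ |ε - δ| * ‖g y‖ / (ε * m) := by
  refine le_div_of_mul_sq_le_mul (by positivity) (by positivity) ?_
  have hxy := hx.2 y hy.1
  have hyx := hy.2 x hx.1
  have hFxy := hF x hx.1 y hy.1
  rw [← neg_sub x y, inner_neg_right] at hxy
  simp only [inner_add_left, real_inner_smul_left, inner_sub_left] at hxy hyx hFxy
  calc ε * m * ‖x - y‖ ^ 2 ≤ ε * ⟪g x - g y, x - y⟫_ℝ := by
        rw [mul_assoc]; exact mul_le_mul_of_nonneg_left (hg x hx.1 y hy.1) hε.le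
    _ ≤ (δ - ε) * ⟪g y, x - y⟫_ℝ := by rw [inner_sub_left]; linarith
    _ ≤ |δ - ε| * |⟪g y, x - y⟫_ℝ| := (le_abs_self _).trans (abs_mul _ _).le
    _ ≤ |ε - δ| * ‖g y‖ * ‖x - y‖ := by
        rw [abs_sub_comm, mul_assoc]; gcongr; exact abs_real_inner_le_norm _ _

theorem unique (hF : ∀ x ∈ s, ∀ y ∈ s, 0 ≤ ⟪F x - F y, x - y⟫_ℝ) (hm : 0 < m)
    (hg : ∀ x ∈ s, ∀ y ∈ s, m * ‖x - y‖ ^ 2 ≤ ⟪g x - g y, x - y⟫_ℝ) (hε : 0 < ε)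
    (hx : IsVISolution (fun x ↦ F x + ε • g x) s x)
    (hy : IsVISolution (fun x ↦ F x + ε • g x) s y) : x = y := by
  simpa [sub_eq_zero] using norm_sub_le hF hm hg hε hx hy

theorem continuousOn_Ioi (hF : ∀ x ∈ s, ∀ y ∈ s, 0 ≤ ⟪F x - F y, x - y⟫_ℝ) (hm : 0 < m)
    (hg : ∀ x ∈ s, ∀ y ∈ s, m * ‖x - y‖ ^ 2 ≤ ⟪g x - g y, x - y⟫_ℝ) {xsol : ℝ → E}
    (hxsol : ∀ ε, 0 < ε → IsVISolution (fun x ↦ F x + ε • g x) s (xsol ε)) :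
    ContinuousOn xsol (Set.Ioi 0) := by
  intro δ (hδ : 0 < δ)
  have hlim : Tendsto (fun ε : ℝ ↦ |ε - δ| * ‖g (xsol δ)‖ / (ε * m)) (𝓝[Set.Ioi 0] δ) (𝓝 0) := by
    have hcont : ContinuousAt (fun ε : ℝ ↦ |ε - δ| * ‖g (xsol δ)‖ / (ε * m)) δ :=
      ContinuousAt.div (by fun_prop) (by fun_prop) (by positivity)
    simpa using hcont.tendsto.mono_left nhdsWithin_le_nhds
  rw [ContinuousWithinAt, tendsto_iff_norm_sub_tendsto_zero]
  refine squeeze_zero' (.of_forall fun _ ↦ norm_nonneg _) ?_ hlim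
  filter_upwards [self_mem_nhdsWithin] with ε hε
  exact norm_sub_le hF hm hg hε (hxsol ε hε) (hxsol δ hδ)

end IsVISolution

variable [CompleteSpace E]

theorem isVISolution_add_gradient_of_minty (hs : Convex ℝ s)
    (hF : ContinuousWithinAt F s x) (hg : HasGradientWithinAt φ (g x) s x) (hx : x ∈ s)
    (hminty : ∀ y ∈ s, ⟪F y, x - y⟫_ℝ + (φ x - φ y) ≤ 0) :
    IsVISolution (fun x ↦ F x + g x) s x := by
  refine ⟨hx, fun y hy ↦ ?_⟩
  have hseg := tendsto_add_smul_sub_nhdsWithin hs hx hy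
  have hlim : Tendsto
      (fun t : ℝ ↦ ⟪F (x + t • (y - x)), y - x⟫_ℝ + t⁻¹ * (φ (x + t • (y - x)) - φ x))
      (𝓝[>] 0) (𝓝 ⟪F x + g x, y - x⟫_ℝ) := by
    rw [inner_add_left]
    exact ((hF.tendsto.comp hseg).inner tendsto_const_nhds).add
      (tendsto_slope_segment_of_hasGradientWithinAt hs hg hx hy)
  refine ge_of_tendsto hlim ?_
  filter_upwards [(tendsto_nhdsWithin_iff.1 hseg).2, self_mem_nhdsWithin] with t hmem (ht : 0 < t)
  have hseg_minty := hminty _ hmem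
  rw [sub_add_cancel_left, inner_neg_right, real_inner_smul_right] at hseg_minty
  calc 0 ≤ t⁻¹ * (t * ⟪F (x + t • (y - x)), y - x⟫_ℝ + (φ (x + t • (y - x)) - φ x)) :=
        mul_nonneg (inv_nonneg.2 ht.le) (by linarith)
    _ = ⟪F (x + t • (y - x)), y - x⟫_ℝ + t⁻¹ * (φ (x + t • (y - x)) - φ x) := by
        rw [mul_add, inv_mul_cancel_left₀ ht.ne']

theorem exists_isVISolution_add_gradient (hne : s.Nonempty) (hcl : IsClosed s)
    (hFcont : ContinuousOn F s) (hFmono : ∀ x ∈ s, ∀ y ∈ s, 0 ≤ ⟪F x - F y, x - y⟫_ℝ)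
    (hm : 0 < m) (hφ : StrongConvexOn s m φ) (hg : ∀ x ∈ s, HasGradientWithinAt φ (g x) s x) :
    ∃ x, IsVISolution (fun x ↦ F x + g x) s x := by
  obtain ⟨y₀, hy₀⟩ := hne
  have hφconv : ConvexOn ℝ s φ := strongConvexOn_zero.1 (hφ.mono hm.le)
  have hφcont : ContinuousOn φ s := fun x hx ↦ (hg x hx).continuousWithinAt
  have hconv (y : E) : ConvexOn ℝ s fun x ↦ ⟪F y, x - y⟫_ℝ + (φ x - φ y) := by
    refine ((((innerₗ E (F y)).convexOn hφ.1).add hφconv).add_const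
      (-⟪F y, y⟫_ℝ - φ y)).congr fun x _ ↦ ?_
    simp only [Pi.add_apply, innerₗ_apply_apply, inner_sub_right]
    ring
  have hmono : ∀ x ∈ s, ∀ y ∈ s,
      ⟪F x, y - x⟫_ℝ + (φ y - φ x) + (⟪F y, x - y⟫_ℝ + (φ x - φ y)) ≤ 0 := fun x hx y hy ↦ by
    have hxy := hFmono x hx y hy
    rw [← neg_sub x y, inner_neg_right]
    rw [inner_sub_left] at hxy
    linarith
  have hclosed (y : E) : IsClosed {x ∈ s | ⟪F y, x - y⟫_ℝ + (φ x - φ y) ≤ 0} :=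
    ContinuousOn.preimage_isClosed_of_isClosed (f := fun x ↦ ⟪F y, x - y⟫_ℝ + (φ x - φ y))
      (by fun_prop) hcl isClosed_Iic
  obtain ⟨x, hx, hminty⟩ := exists_forall_bifunction_nonpos (fun y _ ↦ hconv y) hmono
    (fun y _ ↦ hclosed y) hy₀
    (isBounded_setOf_inner_add_sub_nonpos hm hφ (hg y₀ hy₀) hy₀ (F y₀))
  exact ⟨x, isVISolution_add_gradient_of_minty hφ.1 (hFcont x hx) (hg x hx) hx hminty⟩

theorem mainTheorem11_general (hne : s.Nonempty) (hcl : IsClosed s) (hFcont : ContinuousOn F s)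
    (hFmono : ∀ x ∈ s, ∀ y ∈ s, 0 ≤ ⟪F x - F y, x - y⟫_ℝ) (hm : 0 < m)
    (hφ : StrongConvexOn s m φ) (hg : ∀ x ∈ s, HasGradientWithinAt φ (g x) s x) :
    ∃ xsol : ℝ → E,
      (∀ ε, 0 < ε → ∀ x, IsVISolution (fun x ↦ F x + ε • g x) s x ↔ x = xsol ε) ∧
      ContinuousOn xsol (Set.Ioi 0) := by
  have hgmono : ∀ x ∈ s, ∀ y ∈ s, m * ‖x - y‖ ^ 2 ≤ ⟪g x - g y, x - y⟫_ℝ := fun x hx y hy ↦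
    mul_norm_sub_sq_le_inner_gradient_sub hφ hg hx hy
  have hexists (ε : ℝ) (hε : 0 < ε) : ∃ x, IsVISolution (fun x ↦ F x + ε • g x) s x :=
    exists_isVISolution_add_gradient hne hcl hFcont hFmono (mul_pos hε hm)
      (strongConvexOn_const_mul hφ hε.le) fun x hx ↦ hasGradientWithinAt_const_mul (hg x hx) ε
  choose! xsol hxsol using hexists
  refine ⟨xsol, fun ε hε x ↦ ⟨fun hx ↦ ?_, fun hx ↦ hx ▸ hxsol ε hε⟩, ?_⟩
  · exact hx.unique hFmono hm hgmono hε (hxsol ε hε)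
  · exact IsVISolution.continuousOn_Ioi hFmono hm hgmono hxsol

end VariationalInequality

/-- `Ω` is a nonempty closed convex set, `F` is continuous, monotone and coercive on `Ω`, and `φ`
is strongly convex and Fréchet differentiable on `Ω` with gradient `gradφ` (if `φ` is
differentiable in the whole space, `gradφ` may be the usual gradient). -/
theorem mainTheorem11 {n : ℕ} (Ω : Set (EuclideanSpace ℝ (Fin n)))
    (hΩne : Ω.Nonempty) (hΩcl : IsClosed Ω) (hΩconv : Convex ℝ Ω)
    (F : EuclideanSpace ℝ (Fin n) → EuclideanSpace ℝ (Fin n))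
    (hFcont : ContinuousOn F Ω) (hFmono : IsMonotoneMapOn F Ω) (hFcoer : IsCoerciveMapOn F Ω)
    (φ : EuclideanSpace ℝ (Fin n) → ℝ) (ρ : ℝ) (hρ : 0 < ρ) (hφconv : StrongConvexOn Ω ρ φ)
    (gradφ : EuclideanSpace ℝ (Fin n) → EuclideanSpace ℝ (Fin n))
    (hφdiff : ∀ x ∈ Ω, HasGradientWithinAt φ (gradφ x) Ω x) :
    ∃ xsol : ℝ → EuclideanSpace ℝ (Fin n),
      (∀ ε : ℝ, 0 < ε → viSol (fun x => F x + ε • gradφ x) Ω = {xsol ε}) ∧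
      ContinuousOn xsol (Set.Ioi 0) := by
  obtain ⟨xsol, hsol, hcont⟩ :=
    mainTheorem11_general hΩne hΩcl hFcont hFmono hρ hφconv hφdiff
  exact ⟨xsol, fun ε hε ↦ Set.ext (hsol ε hε), hcont⟩
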